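/- Let $k$ be an uncountable algebraically closed field of characteristic $p>0$, let $A=k[[X_1,\dots,X_n]]$, let $f_1,\dots,f_l\in A$ ($l\ge 0$) be a regular sequence, and let $\tilde R=A/(f_1,\dots,f_l)$ be the corresponding complete intersection ring. Let $f,g\in A$ be elements that form a regular sequence on $\tilde R$ (a regular sequence is understood to generate a proper ideal), and let $h\in\tilde R$ be a nonzero element of the maximal ideal of $\tilde R$. Then there exists a subset $V\subset k$, dense in the Zariski topology of $k\simeq\operatorname{Max}(k[t])$, such that for all $a\in V$ the elements $ah+f,\ g$ form a regular sequence on $\tilde R$ and $$e_{HK}\bigl(\tilde R/(f,g)\bigr)\ \ge\ e_{HK}\bigl(\tilde R/(ah+f,g)\bigr).$$ Here, for a Noetherian local ring $(S,\mathfrak m)$ of characteristic $p$ and dimension $d$, $e_{HK}(S)=\lim_{e\to\infty}\lambda_S\bigl(S/\mathfrak m^{[p^e]}\bigr)/p^{ed}$ is the Hilbert–Kunz multiplicity, where $\lambda_S$ denotes length and $\mathfrak m^{[q]}$ is the ideal generated by the $q$-th powers of the elements of $\mathfrak m$. -/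

import Mathlib

open Filter Topology
open scoped ENNReal

noncomputable section

/-- The `q`-th Frobenius power `I^[q]` of an ideal: the ideal generated by the `q`-th powers of
the elements of `I`. -/
def frobeniusPower {S : Type*} [CommRing S] (I : Ideal S) (q : ℕ) : Ideal S :=
  Ideal.span ((fun x : S => x ^ q) '' (I : Set S))

/-- The Krull dimension as a natural number (for rings of finite dimension, such as Noetherian
local rings). -/
def krullDimNat (S : Type*) [CommRing S] : ℕ :=
  ((ringKrullDim S).unbotD 0).toNat

/-- The normalized Hilbert-Kunz function `e ↦ λ(S / 𝔪^[p^e]) / (p^e)^(dim S)` of a local ring. -/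
def hkFunction (p : ℕ) (S : Type*) [CommRing S] [IsLocalRing S] (e : ℕ) : ℝ≥0∞ :=
  ((Module.length S (S ⧸ frobeniusPower (IsLocalRing.maximalIdeal S) (p ^ e)) : ℕ∞) : ℝ≥0∞) /
    ((p : ℝ≥0∞) ^ e) ^ krullDimNat S

/-- The Hilbert-Kunz multiplicity of a local ring of characteristic `p` at its maximal ideal. It is
the limit of the normalized Hilbert-Kunz function, see `hkMultiplicity_eq_of_tendsto`; the upper
limit makes the definition total. -/
def hkMultiplicity (p : ℕ) (S : Type*) [CommRing S] [IsLocalRing S] : ℝ≥0∞ :=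
  limsup (hkFunction p S) atTop

theorem hkMultiplicity_eq_of_tendsto {p : ℕ} {S : Type*} [CommRing S] [IsLocalRing S] {c : ℝ≥0∞}
    (hc : Tendsto (hkFunction p S) atTop (𝓝 c)) : hkMultiplicity p S = c :=
  hc.limsup_eq

/-- The maximal ideal `(t - a)` of `k[t]`, given as the kernel of evaluation at `a`, as a point of
the maximal spectrum. -/
def affineLinePoint {k : Type*} [Field k] (a : k) : MaximalSpectrum (Polynomial k) :=
  ⟨RingHom.ker (Polynomial.evalRingHom a),
    RingHom.ker_isMaximal_of_surjective _ fun b => ⟨Polynomial.C b, by simp⟩⟩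

/-- Density in the Zariski topology of `k`, identified with `Max k[t]` through `a ↦ (t - a)`. -/
def ZariskiDense {k : Type*} [Field k] (V : Set k) : Prop :=
  Dense (affineLinePoint '' V)

end

/-! The Hilbert–Kunz functions are compared term by term. For a Noetherian local `k`-algebra `R`
with residue field `k` and `q = p ^ e`, the ring `R/((g) + 𝔪^[q])` is a finite-dimensional
`k`-space, and killing `x` in it leaves the cokernel of multiplication by `x`. So the length
belonging to `(x, g)` is a fixed dimension minus the rank of that multiplication
(`length_quotient_frobeniusPower_add_finrank_range`). Along the pencil `x = a • h + f` the rank is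
lower semicontinuous: for each `e` it falls below its value at `a = 0` for only finitely many `a`
(`finite_setOf_finrank_range_smul_add_lt`). Regularity also fails for only finitely many `a`, by
prime avoidance over the associated primes of `R/(g)`. Letting `e` vary excludes countably many `a`
in all; since `k` is uncountable, an infinite, hence Zariski dense, set remains. Both quotients have
dimension `dim R - 2`, so the normalizing denominators agree. -/

/-! ### Generic behaviour along a pencil -/

/-- In a Noetherian module over a Noetherian algebra over a field, a regular element stays regular
under all but finitely many perturbations along a line. -/
theorem finite_setOf_not_isSMulRegular_smul_add {k R M : Type*} [Field k] [CommRing R]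
    [IsNoetherianRing R] [Algebra k R] [AddCommGroup M] [Module R M] [Module.Finite R M]
    (f h : R) (hf : IsSMulRegular M f) : {a : k | ¬ IsSMulRegular M (a • h + f)}.Finite := by
  -- Two points of the line in `P` would put `h`, and then `f`, in `P`.
  have key (P : Ideal R) (hP : f ∉ P) : {a : k | a • h + f ∈ P}.Subsingleton := by
    intro a ha b hb
    by_contra hab
    have h1 : (a - b) • h ∈ P := by
      have := P.sub_mem ha hb
      rwa [add_sub_add_right_eq_sub, ← sub_smul] at this
    have h2 : h ∈ P := by
      have := Submodule.smul_of_tower_mem P (a - b)⁻¹ h1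
      rwa [inv_smul_smul₀ (sub_ne_zero.mpr hab)] at this
    exact hP ((P.add_mem_iff_right (Submodule.smul_of_tower_mem P a h2)).mp ha)
  have hU := biUnion_associatedPrimes_eq_compl_regular R M
  refine ((associatedPrimes.finite R M).biUnion (t := fun P => {a : k | a • h + f ∈ P})
    fun P hP => (key P fun hfP => ?_).finite).subset fun a ha => ?_
  · have : f ∈ {r : R | IsSMulRegular M r}ᶜ := hU ▸ Set.mem_biUnion hP hfP
    exact this hf
  · have : a • h + f ∈ ⋃ p ∈ associatedPrimes R M, (p : Set R) := hU ▸ ha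
    simpa using this

/-- The rank of a pencil of linear maps does not drop at all but finitely many points. -/
theorem finite_setOf_finrank_range_smul_add_lt {k M : Type*} [Field k] [AddCommGroup M]
    [Module k M] [FiniteDimensional k M] (u v : M →ₗ[k] M) :
    {a : k | Module.finrank k (LinearMap.range (a • v + u)) <
      Module.finrank k (LinearMap.range u)}.Finite := by
  obtain ⟨N, hN⟩ := (LinearMap.ker u).exists_isCompl
  obtain ⟨π, hπ⟩ := (LinearMap.range u).subtype.exists_leftInverse_of_injective
    (Submodule.ker_subtype _)
  let ε : LinearMap.range u ≃ₗ[k] N := (u.kerComplementEquivRange hN.symm).symm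
  -- Compression of `w` to a square block: invert `u` on a complement of its kernel, apply `w`,
  -- project to the range of `u`. Then `T u = id`, so `det (T (a • v + u))` is a polynomial in `a`
  -- with value `1` at `0`.
  let T (w : M →ₗ[k] M) : LinearMap.range u →ₗ[k] LinearMap.range u :=
    π ∘ₗ w ∘ₗ N.subtype ∘ₗ ε.toLinearMap
  have hTu : T u = LinearMap.id := by
    ext x
    obtain ⟨y, rfl⟩ := (u.kerComplementEquivRange hN.symm).surjective x
    have := LinearMap.congr_fun hπ (u.kerComplementEquivRange hN.symm y)
    simpa [T, ε] using congrArg Subtype.val this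
  let b := Module.finBasis k (LinearMap.range u)
  let A := LinearMap.toMatrix b b (T v)
  let P : Polynomial k := Matrix.det ((Polynomial.X : Polynomial k) • A.map Polynomial.C + 1)
  have hP (a : k) : P.eval a = LinearMap.det (T (a • v + u)) := by
    have h1 : T (a • v + u) = a • T v + LinearMap.id := by
      rw [← hTu]; ext x; simp [T]
    rw [h1, ← LinearMap.det_toMatrix b, map_add, map_smul, LinearMap.toMatrix_id,
      ← Polynomial.coe_evalRingHom, RingHom.map_det]
    congr 1
    ext i j
    by_cases hij : i = j
    · subst hij; simp [A, mul_comm a]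
    · simp [A, hij, mul_comm a]
  have hP0 : P ≠ 0 := by
    intro h0
    have := hP 0
    simp [h0, hTu] at this
  refine P.rootSet_finite k |>.subset fun a ha => ?_
  rw [Polynomial.mem_rootSet]
  refine ⟨hP0, ?_⟩
  rw [Polynomial.coe_aeval_eq_eval, hP]
  by_contra hdet
  have hsurj : Function.Surjective (T (a • v + u)) :=
    (LinearMap.equivOfDetNeZero (T (a • v + u)) hdet).surjective
  -- Since the compression is onto, `π` carries the range of `a • v + u` onto that of `u`.
  have hle : Module.finrank k (LinearMap.range u) ≤
      Module.finrank k (LinearMap.range (a • v + u)) := by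
    rw [← finrank_top k (LinearMap.range u), ← LinearMap.range_eq_top.mpr hsurj]
    refine le_trans (Submodule.finrank_mono (t := (LinearMap.range (a • v + u)).map π) ?_)
      (Submodule.finrank_map_le π _)
    rintro _ ⟨x, rfl⟩
    exact Submodule.mem_map_of_mem ⟨_, rfl⟩
  exact absurd ha (not_lt.mpr hle)

/-- The rank of multiplication by `a h + f` is at least that by `f` for almost all `a`. -/
theorem finite_setOf_finrank_range_mulLeft_lt {k S : Type*} [Field k] [CommRing S] [Algebra k S]
    [FiniteDimensional k S] (f h : S) :
    {a : k | Module.finrank k (LinearMap.range (LinearMap.mulLeft k (a • h + f))) <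
      Module.finrank k (LinearMap.range (LinearMap.mulLeft k f))}.Finite := by
  have hadd (a : k) : LinearMap.mulLeft k (a • h + f) =
      a • LinearMap.mulLeft k h + LinearMap.mulLeft k f := by
    ext y
    simp [add_mul]
  refine (finite_setOf_finrank_range_smul_add_lt (LinearMap.mulLeft k f)
    (LinearMap.mulLeft k h)).subset fun a ha => ?_
  rw [Set.mem_ofPred_eq] at ha ⊢
  rwa [← hadd]

/-! ### Lengths, Frobenius powers and `k`-dimensions -/

/-- Over a local `k`-algebra with residue field `k`, the length is the dimension over `k`. -/
theorem length_eq_length_of_residue {k R : Type*} {M : Type*} [Field k] [CommRing R]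
    [IsLocalRing R] [Algebra k R]
    (hres : ∀ r : R, ∃ c : k, r - algebraMap k R c ∈ IsLocalRing.maximalIdeal R)
    [AddCommGroup M] [Module R M] [Module k M] [IsScalarTower k R M] :
    Module.length R M = Module.length k M := by
  refine le_antisymm ?_ ?_
  · have := Submodule.length_le_length_restrictScalars k (⊤ : Submodule R M)
    rw [Module.length_top, Submodule.restrictScalars_top] at this
    rwa [Module.length_top] at this
  by_cases htop : Module.length R M = ⊤
  · simp [htop]
  rw [← ne_eq, Module.length_ne_top_iff] at htop
  revert ‹Module k M›
  induction htop with
  | of_subsingleton => intro _ _; simp [Module.length_eq_zero]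
  | @of_simple_quotient M _ _ N hs _ ih =>
    intro _ _
    have hadd := Module.length_eq_add_of_exact N.subtype N.mkQ N.injective_subtype
      N.mkQ_surjective (LinearMap.exact_subtype_mkQ N)
    have hadd' := Module.length_eq_add_of_exact (N.subtype.restrictScalars k)
      (N.mkQ.restrictScalars k) N.injective_subtype
      N.mkQ_surjective (LinearMap.exact_subtype_mkQ N)
    rw [hadd, hadd', Module.length_eq_one R (M ⧸ N)]
    refine add_le_add ih ?_
    obtain ⟨x, hx⟩ := @exists_ne (M ⧸ N) (IsSimpleModule.nontrivial R (M ⧸ N)) 0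
    have hsurj := IsSimpleModule.toSpanSingleton_surjective R hx
    have hmax := IsSimpleModule.ker_toSpanSingleton_isMaximal R hx
    have hker := IsLocalRing.eq_maximalIdeal hmax
    -- The maximal ideal kills `x`, and every `r` is a scalar modulo it, so `x` spans the simple
    -- quotient already over `k`.
    have hk : Function.Surjective (LinearMap.toSpanSingleton k (M ⧸ N) x) := by
      intro y
      obtain ⟨r, rfl⟩ := hsurj y
      obtain ⟨c, hc⟩ := hres r
      rw [← hker, LinearMap.mem_ker, map_sub, sub_eq_zero] at hc
      exact ⟨c, by simpa using hc.symm⟩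
    exact (Module.length_le_of_surjective _ hk).trans (by simp)

/-- The Frobenius powers of the maximal ideal of a quotient of a local ring are the images of
those of the maximal ideal of the ring. -/
theorem frobeniusPower_maximalIdeal_quotient {R : Type*} [CommRing R] [IsLocalRing R] (I : Ideal R)
    [IsLocalRing (R ⧸ I)] (q : ℕ) :
    frobeniusPower (IsLocalRing.maximalIdeal (R ⧸ I)) q =
      (frobeniusPower (IsLocalRing.maximalIdeal R) q).map (Ideal.Quotient.mk I) := by
  have hloc : IsLocalHom (Ideal.Quotient.mk I) :=
    IsLocalHom.of_surjective _ Ideal.Quotient.mk_surjective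
  rw [frobeniusPower, frobeniusPower, Ideal.map_span, ← Set.image_comp]
  congr 1
  ext y
  constructor
  · rintro ⟨s, hs, rfl⟩
    obtain ⟨r, rfl⟩ := Ideal.Quotient.mk_surjective s
    refine ⟨r, ?_, by simp⟩
    simp only [SetLike.mem_coe, IsLocalRing.mem_maximalIdeal, mem_nonunits_iff] at hs ⊢
    exact fun hu => hs (hu.map _)
  · rintro ⟨r, hr, rfl⟩
    refine ⟨Ideal.Quotient.mk I r, ?_, by simp⟩
    simp only [SetLike.mem_coe, IsLocalRing.mem_maximalIdeal, mem_nonunits_iff] at hr ⊢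
    exact fun hu => hr (isUnit_of_map_unit _ _ hu)

/-- A quotient by an ideal containing a Frobenius power of the maximal ideal is finite dimensional
over the residue field. -/
theorem finiteDimensional_quotient_of_frobeniusPower_le {k R : Type*} [Field k] [CommRing R]
    [IsLocalRing R] [IsNoetherianRing R] [Algebra k R]
    (hres : ∀ r : R, ∃ c : k, r - algebraMap k R c ∈ IsLocalRing.maximalIdeal R)
    (J : Ideal R) (q : ℕ) (hJ : frobeniusPower (IsLocalRing.maximalIdeal R) q ≤ J) :
    FiniteDimensional k (R ⧸ J) := by
  have hrad : IsLocalRing.maximalIdeal R ≤ J.radical := fun x hx =>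
    ⟨q, hJ (Ideal.subset_span ⟨x, hx, rfl⟩)⟩
  obtain ⟨N, hN⟩ := Ideal.exists_pow_le_of_le_radical_of_fg hrad
    (IsNoetherian.noetherian (IsLocalRing.maximalIdeal R))
  have hart : IsArtinianRing (R ⧸ J) := by
    -- `J` can be the unit ideal, for instance when `q = 0`.
    rcases subsingleton_or_nontrivial (R ⧸ J) with hs | hs
    · infer_instance
    have hl : IsLocalRing (R ⧸ J) := .of_surjective' _ Ideal.Quotient.mk_surjective
    rw [isArtinianRing_iff_isNilpotent_maximalIdeal]
    refine ⟨N, ?_⟩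
    rw [← IsLocalRing.map_maximalIdeal_of_surjective (Ideal.Quotient.mk J)
      Ideal.Quotient.mk_surjective, ← Ideal.map_pow, Ideal.zero_eq_bot, eq_bot_iff]
    exact (Ideal.map_mono hN).trans (Ideal.map_quotient_self J).le
  have h1 : Module.length k (R ⧸ J) ≠ ⊤ := by
    rw [← length_eq_length_of_residue hres,
      Module.length_eq_of_surjective (R := R ⧸ J) Ideal.Quotient.mk_surjective]
    exact Module.length_ne_top
  rw [Module.length_ne_top_iff, isFiniteLength_iff_isNoetherian_isArtinian] at h1
  have := h1.1
  infer_instance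

/-- An infinite subset of the affine line is dense in the Zariski topology. -/
theorem zariskiDense_of_infinite {k : Type*} [Field k] {V : Set k} (hV : V.Infinite) :
    ZariskiDense V := by
  rw [ZariskiDense, dense_iff_inter_open]
  rintro _ ⟨U, hU, rfl⟩ ⟨x, hx⟩
  obtain ⟨_, ⟨φ, rfl⟩, hxφ, hφU⟩ :=
    PrimeSpectrum.isTopologicalBasis_basic_opens.exists_subset_of_mem_open hx hU
  have hφ : φ ≠ 0 := by
    rintro rfl
    simp at hxφ
  -- The basic open set of `φ ≠ 0` misses only the finitely many roots of `φ`.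
  obtain ⟨a, haV, ha⟩ := (hV.sdiff (φ.rootSet_finite k)).nonempty
  refine ⟨affineLinePoint a, hφU ?_, a, haV, rfl⟩
  rw [Polynomial.mem_rootSet, not_and] at ha
  simpa [affineLinePoint, MaximalSpectrum.toPrimeSpectrum, RingHom.mem_ker] using ha hφ

/-- The length of `R / ((x, g) + 𝔪^[q])` plus the rank of multiplication by `x` on
`R / ((g) + 𝔪^[q])` is the length of the latter ring. -/
theorem length_quotient_frobeniusPower_add_finrank_range {k R : Type*} [Field k] [CommRing R]
    [IsLocalRing R] [IsNoetherianRing R] [Algebra k R]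
    (hres : ∀ r : R, ∃ c : k, r - algebraMap k R c ∈ IsLocalRing.maximalIdeal R)
    (x g : R) [IsLocalRing (R ⧸ Ideal.span {x, g})] (q : ℕ) :
    Module.length (R ⧸ Ideal.span {x, g}) ((R ⧸ Ideal.span {x, g}) ⧸
        frobeniusPower (IsLocalRing.maximalIdeal (R ⧸ Ideal.span {x, g})) q) +
      (Module.finrank k (LinearMap.range (LinearMap.mulLeft k (Ideal.Quotient.mk
        (Ideal.span {g} ⊔ frobeniusPower (IsLocalRing.maximalIdeal R) q) x))) : ℕ∞) =
    (Module.finrank k (R ⧸ (Ideal.span {g} ⊔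
      frobeniusPower (IsLocalRing.maximalIdeal R) q)) : ℕ∞) := by
  set F := frobeniusPower (IsLocalRing.maximalIdeal R) q
  set M := R ⧸ (Ideal.span {g} ⊔ F)
  have hfin : FiniteDimensional k M :=
    finiteDimensional_quotient_of_frobeniusPower_le hres _ q le_sup_right
  have hresS (s : R ⧸ Ideal.span {x, g}) : ∃ c : k, s - algebraMap k _ c ∈
      IsLocalRing.maximalIdeal (R ⧸ Ideal.span {x, g}) := by
    obtain ⟨r, rfl⟩ := Ideal.Quotient.mk_surjective s
    obtain ⟨c, hc⟩ := hres r
    refine ⟨c, ?_⟩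
    rw [← IsLocalRing.map_maximalIdeal_of_surjective (Ideal.Quotient.mk (Ideal.span {x, g}))
      Ideal.Quotient.mk_surjective]
    simpa using Ideal.mem_map_of_mem (Ideal.Quotient.mk (Ideal.span {x, g})) hc
  let x' : M := Ideal.Quotient.mk _ x
  have hrange : LinearMap.range (LinearMap.mulLeft k x') =
      (Ideal.span {x'}).restrictScalars k := by
    ext y
    simp [Ideal.mem_span_singleton', mul_comm]
  have hmap : Ideal.span {x'} =
      (Ideal.span {x}).map (Ideal.Quotient.mkₐ k (Ideal.span {g} ⊔ F)) := by
    rw [Ideal.map_span, Set.image_singleton]; rfl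
  have hsup : Ideal.span {x, g} ⊔ F = (Ideal.span {g} ⊔ F) ⊔ Ideal.span {x} := by
    rw [Ideal.span_insert, sup_assoc, sup_comm]
  -- Both iterated quotients are `R/((x, g) + 𝔪^[q])`, reached by killing `(x, g)` first or `x`
  -- last.
  let e₁ := (Ideal.quotientEquivAlgOfEq k (frobeniusPower_maximalIdeal_quotient
    (Ideal.span {x, g}) q)).trans (DoubleQuot.quotQuotEquivQuotSupₐ k (Ideal.span {x, g}) F)
  let e₂ := (Ideal.quotientEquivAlgOfEq k hmap).trans
    (DoubleQuot.quotQuotEquivQuotSupₐ k (Ideal.span {g} ⊔ F) (Ideal.span {x}))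
  let e := (e₁.trans (Ideal.quotientEquivAlgOfEq k hsup)).trans e₂.symm
  have e' := (e.toLinearEquiv.trans (Submodule.Quotient.restrictScalarsEquiv k _).symm).trans
    (Submodule.quotEquivOfEq _ _ hrange.symm)
  rw [length_eq_length_of_residue hresS, e'.length_eq, Module.length_eq_finrank]
  exact_mod_cast Submodule.finrank_quotient_add_finrank _

/-! ### Comparison of Hilbert–Kunz multiplicities -/

open RingTheory.Sequence in
/-- For a regular sequence `f, g` in a Noetherian local `k`-algebra with uncountable residue field
`k` and a nonunit `h`, the Hilbert-Kunz multiplicity does not increase from `R / (f, g)` to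
`R / (a h + f, g)` for all but countably many `a`. -/
theorem exists_zariskiDense_forall_hkMultiplicity_le (p : ℕ) {k R : Type*} [Field k]
    [Uncountable k] [CommRing R] [IsLocalRing R] [IsNoetherianRing R] [Algebra k R]
    (hres : ∀ r : R, ∃ c : k, r - algebraMap k R c ∈ IsLocalRing.maximalIdeal R)
    (f g h : R) (hfg : IsRegular R [f, g]) (hh : ¬ IsUnit h) :
    ∃ V : Set k, ZariskiDense V ∧ ∀ a ∈ V, IsRegular R [a • h + f, g] ∧
      ∃ (_ : IsLocalRing (R ⧸ Ideal.span {f, g}))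
        (_ : IsLocalRing (R ⧸ Ideal.span {a • h + f, g})),
        hkMultiplicity p (R ⧸ Ideal.span {f, g}) ≥
          hkMultiplicity p (R ⧸ Ideal.span {a • h + f, g}) := by
  have hspan (x : R) : Ideal.ofList [x, g] = Ideal.span {x, g} := by
    rw [Ideal.ofList_cons, Ideal.ofList_singleton, Ideal.span_insert]
  have hlocal {x : R} (hx : IsRegular R [x, g]) : IsLocalRing (R ⧸ Ideal.span {x, g}) := by
    have : Nontrivial (R ⧸ Ideal.span {x, g}) := by
      rw [Ideal.Quotient.nontrivial_iff]
      intro htop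
      apply hx.top_ne_smul
      rw [hspan, htop, Submodule.top_smul]
    exact .of_surjective' _ Ideal.Quotient.mk_surjective
  have hdim {x : R} (hx : IsRegular R [x, g]) :
      ringKrullDim (R ⧸ Ideal.span {x, g}) + 2 = ringKrullDim R := by
    have := ringKrullDim_add_length_eq_ringKrullDim_of_isRegular _ hx
    rw [hspan] at this
    simpa using this
  have hl₀ := hlocal hfg
  have hmem (y : R) (hy : y ∈ ({f, g} : Set R)) : y ∈ IsLocalRing.maximalIdeal R :=
    IsLocalRing.le_maximalIdeal (Ideal.Quotient.nontrivial_iff.mp hl₀.toNontrivial)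
      (Ideal.subset_span hy)
  let I (e : ℕ) := Ideal.span {g} ⊔ frobeniusPower (IsLocalRing.maximalIdeal R) (p ^ e)
  have hfin (e : ℕ) : FiniteDimensional k (R ⧸ I e) :=
    finiteDimensional_quotient_of_frobeniusPower_le hres _ _ le_sup_right
  have hsmul (e : ℕ) (a : k) : Ideal.Quotient.mk (I e) (a • h + f) =
      a • Ideal.Quotient.mk (I e) h + Ideal.Quotient.mk (I e) f := by
    rw [map_add]; rfl
  let B : Set k := {a | ¬ IsSMulRegular (QuotSMulTop g R) (a • h + f)} ∪
    ⋃ e, {a | Module.finrank k (LinearMap.range (LinearMap.mulLeft k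
        (Ideal.Quotient.mk (I e) (a • h + f)))) <
      Module.finrank k (LinearMap.range (LinearMap.mulLeft k (Ideal.Quotient.mk (I e) f)))}
  -- In a Noetherian local ring regular sequences may be permuted. With `g` first, regularity of the
  -- perturbed sequence is a condition on one element acting on `R/(g)`.
  have hgf : IsRegular R [g, f] := IsLocalRing.isRegular_of_perm hfg (.swap _ _ _)
  rw [isRegular_cons_iff, isRegular_cons_iff] at hgf
  have hB : B.Countable :=
    (finite_setOf_not_isSMulRegular_smul_add f h hgf.2.1).countable.union
      (Set.countable_iUnion fun e =>
        by
        have := hfin e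
        refine (finite_setOf_finrank_range_mulLeft_lt (k := k) (Ideal.Quotient.mk (I e) f)
          (Ideal.Quotient.mk (I e) h)).countable.mono fun a ha => ?_
        rw [Set.mem_ofPred_eq] at ha ⊢
        rwa [← hsmul])
  refine ⟨Bᶜ, zariskiDense_of_infinite ?_, fun a ha => ?_⟩
  · intro hfinite
    have := hB.union hfinite.countable
    rw [Set.union_compl_self, Set.countable_univ_iff] at this
    exact not_countable this
  simp only [B, Set.mem_compl_iff, Set.mem_union, Set.mem_iUnion, not_or, not_exists,
    Set.mem_ofPred_eq, not_not, not_lt] at ha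
  have hreg : IsRegular R [a • h + f, g] := by
    have : IsRegular R [g, a • h + f] := by
      refine ⟨?_, ?_⟩
      · simp [hgf.1, ha.1]
      · rw [smul_eq_mul, Ideal.mul_top]
        refine fun htop => (IsLocalRing.maximalIdeal.isMaximal R).ne_top (top_le_iff.mp (htop.le.trans ?_))
        rw [Ideal.ofList_cons, Ideal.ofList_singleton, sup_le_iff,
          Ideal.span_singleton_le_iff_mem, Ideal.span_singleton_le_iff_mem]
        exact ⟨hmem _ (by simp), add_mem (Submodule.smul_of_tower_mem _ a hh)
          (hmem _ (by simp))⟩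
    exact IsLocalRing.isRegular_of_perm this (.swap _ _ _)
  have hl := hlocal hreg
  refine ⟨hreg, hl₀, hl, Filter.limsup_le_limsup (.of_forall fun e => ?_)⟩
  have hd : krullDimNat (R ⧸ Ideal.span {a • h + f, g}) =
      krullDimNat (R ⧸ Ideal.span {f, g}) := by
    have := (hdim hreg).trans (hdim hfg).symm
    rw [krullDimNat, krullDimNat]
    generalize ringKrullDim (R ⧸ Ideal.span {a • h + f, g}) = d₁ at this
    generalize ringKrullDim (R ⧸ Ideal.span {f, g}) = d₂ at this
    suffices d₁ = d₂ by rw [this]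
    exact ENat.WithBot.add_ofNat_cancel.mp this
  have hlen : Module.length (R ⧸ Ideal.span {a • h + f, g}) ((R ⧸ Ideal.span {a • h + f, g}) ⧸ frobeniusPower
        (IsLocalRing.maximalIdeal (R ⧸ Ideal.span {a • h + f, g})) (p ^ e)) ≤
      Module.length (R ⧸ Ideal.span {f, g}) ((R ⧸ Ideal.span {f, g}) ⧸ frobeniusPower
        (IsLocalRing.maximalIdeal (R ⧸ Ideal.span {f, g})) (p ^ e)) := by
    have h1 := length_quotient_frobeniusPower_add_finrank_range hres (a • h + f) g (p ^ e)
    have h2 := length_quotient_frobeniusPower_add_finrank_range hres f g (p ^ e)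
    -- Length plus rank is the same for `f` and `a • h + f`, so the larger rank gives the smaller
    -- length.
    have h3 := Nat.cast_le (α := ℕ∞).mpr (ha.2 e)
    exact (ENat.add_le_add_iff_right (ENat.natCast_ne_top _)).mp
      ((add_le_add le_rfl h3).trans (h1.trans h2.symm).le)
  rw [hkFunction, hkFunction, hd]
  gcongr

theorem mainTheorem5 (p : ℕ) [Fact p.Prime] (k : Type*) [Field k] [IsAlgClosed k] [Uncountable k]
    [CharP k p] (n : ℕ) (fs : List (MvPowerSeries (Fin n) k))
    (hfs : RingTheory.Sequence.IsRegular (MvPowerSeries (Fin n) k) fs)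
    (f g : MvPowerSeries (Fin n) k)
    (hfg : RingTheory.Sequence.IsRegular (MvPowerSeries (Fin n) k ⧸ Ideal.ofList fs)
      [Ideal.Quotient.mk (Ideal.ofList fs) f, Ideal.Quotient.mk (Ideal.ofList fs) g])
    (h : MvPowerSeries (Fin n) k ⧸ Ideal.ofList fs) (h_ne : h ≠ 0) (h_nonunit : ¬ IsUnit h) :
    ∃ V : Set k, ZariskiDense V ∧ ∀ a ∈ V,
      RingTheory.Sequence.IsRegular (MvPowerSeries (Fin n) k ⧸ Ideal.ofList fs)
        [a • h + Ideal.Quotient.mk (Ideal.ofList fs) f, Ideal.Quotient.mk (Ideal.ofList fs) g] ∧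
      ∃ (_ : IsLocalRing ((MvPowerSeries (Fin n) k ⧸ Ideal.ofList fs) ⧸ Ideal.span
            {Ideal.Quotient.mk (Ideal.ofList fs) f, Ideal.Quotient.mk (Ideal.ofList fs) g}))
        (_ : IsLocalRing ((MvPowerSeries (Fin n) k ⧸ Ideal.ofList fs) ⧸ Ideal.span
            {a • h + Ideal.Quotient.mk (Ideal.ofList fs) f,
              Ideal.Quotient.mk (Ideal.ofList fs) g})),
        hkMultiplicity p ((MvPowerSeries (Fin n) k ⧸ Ideal.ofList fs) ⧸ Ideal.span
            {Ideal.Quotient.mk (Ideal.ofList fs) f, Ideal.Quotient.mk (Ideal.ofList fs) g}) ≥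
          hkMultiplicity p ((MvPowerSeries (Fin n) k ⧸ Ideal.ofList fs) ⧸ Ideal.span
            {a • h + Ideal.Quotient.mk (Ideal.ofList fs) f,
              Ideal.Quotient.mk (Ideal.ofList fs) g}) := by
  -- Locality of the quotient needs it to be nonzero, which `h ≠ 0` witnesses.
  have hne : Nontrivial (MvPowerSeries (Fin n) k ⧸ Ideal.ofList fs) := ⟨h, 0, h_ne⟩
  have hloc : IsLocalRing (MvPowerSeries (Fin n) k ⧸ Ideal.ofList fs) :=
    .of_surjective' _ Ideal.Quotient.mk_surjective
  refine exists_zariskiDense_forall_hkMultiplicity_le p (k := k) (fun r => ?_) _ _ h hfg h_nonunit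
  obtain ⟨φ, rfl⟩ := Ideal.Quotient.mk_surjective r
  -- The constant coefficient represents the residue class, so the residue field is `k`.
  refine ⟨MvPowerSeries.constantCoeff φ, ?_⟩
  rw [IsLocalRing.mem_maximalIdeal, mem_nonunits_iff]
  have hsub : Ideal.Quotient.mk (Ideal.ofList fs) φ -
      algebraMap k _ (MvPowerSeries.constantCoeff φ) =
      Ideal.Quotient.mk (Ideal.ofList fs)
        (φ - MvPowerSeries.C (MvPowerSeries.constantCoeff φ)) := by
    rw [map_sub]; rfl
  rw [hsub]
  have := IsLocalHom.of_surjective (Ideal.Quotient.mk (Ideal.ofList fs))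
    Ideal.Quotient.mk_surjective
  rw [isUnit_map_iff, MvPowerSeries.isUnit_iff_constantCoeff]
  simp
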